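/- Let $b\ge 2$ be an integer and $\Sigma_b=\{0,\dots,b-1\}$. For a finite word $w\in\Sigma_b^*$ put $\mathrm{real}_b(w)=\sum_{i=1}^{|w|} w[i-1]\,b^{-i}$; for $x\in[0,1)$ let $\mathrm{seq}_b(x)\in\Sigma_b^\infty$ be the base-$b$ expansion of $x$ that does not end in infinitely many digits $b-1$. A $\Sigma_b$-finite-state transducer ($\Sigma_b$-FST) is a tuple $T=(Q,\tau,\nu,q_0)$ with a finite set of states $Q$, a transition function $\tau:Q\times\Sigma_b\to Q$, an output function $\nu:Q\times\Sigma_b\to\Sigma_b^*$ and an initial state $q_0\in Q$; its output $T(\pi)$ on input $\pi\in\Sigma_b^*$ is the concatenation of the words emitted by $\nu$ while $T$ reads $\pi$ from $q_0$. For $w\in\Sigma_b^*$, $x\in[0,1)$ and $\delta>0$ put $$\mathrm K^T(w)=\min\{|\pi| : T(\pi)=w\},\qquad \mathrm K^T_\delta(x)=\min\{\mathrm K^T(w) : w\in\Sigma_b^*,\ |\mathrm{real}_b(w)-x|<\delta\},$$ where the minimum of the empty set is $\infty$. The base-$b$ finite-state dimension of $x$ is $$\dim_{\mathrm{FS}}^b(x)=\inf_{T\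 \Sigma_b\text{-FST}}\ \liminf_{\delta\to 0^+}\frac{\mathrm K^T_\delta(x)}{\log_b(1/\delta)} .$$ The number $x$ is $b$-normal (Borel normal in base $b$) if every word $w\in\Sigma_b^*$ occurs in $\mathrm{seq}_b(x)$ with asymptotic frequency $b^{-|w|}$, that is, $\frac1n\,\#\{i<n : w \text{ occurs in } \mathrm{seq}_b(x) \text{ at position } i\}\to b^{-|w|}$ as $n\to\infty$. Then for every $x\in[0,1)$: $x$ is $b$-normal if and only if $\dim_{\mathrm{FS}}^b(x)=1$. -/

import Mathlib

open scoped ENNReal Topology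

namespace FSDim

/-- A finite-state transducer over the alphabet `α`: a finite set of states with an initial state,
a transition function, and an output function that emits a (possibly empty) string per symbol. -/
structure Transducer (α : Type) where
  /-- the set of states -/
  Q : Type
  /-- there are finitely many states -/
  finite_states : Finite Q
  /-- the transition function -/
  next : Q → α → Q
  /-- the output function -/
  out : Q → α → List α
  /-- the initial state -/
  start : Q

namespace Transducer

variable {α : Type}

/-- The state reached from `q` after reading `w`. -/
def run (T : Transducer α) (q : T.Q) (w : List α) : T.Q :=
  w.foldl T.next q

/-- The output produced from state `q` on input `w`. -/
def outputFrom (T : Transducer α) : T.Q → List α → List α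
  | _, [] => []
  | q, a :: w => T.out q a ++ T.outputFrom (T.next q a) w

/-- The output `T(w)`, produced from the initial state on input `w`. -/
def output (T : Transducer α) (w : List α) : List α :=
  T.outputFrom T.start w

theorem outputFrom_concat (T : Transducer α) (q : T.Q) (w : List α) (a : α) :
    T.outputFrom q (w ++ [a]) = T.outputFrom q w ++ T.out (T.run q w) a := by
  induction w generalizing q with
  | nil => simp [outputFrom, run]
  | cons c w ih => simp [outputFrom, run, ih]

/-- The `T`-information content of the string `w`: the least length of an input on which `T`
outputs `w`, and `⊤` if there is none. -/
noncomputable def infoContent (T : Transducer α) (w : List α) : ℕ∞ :=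
  ⨅ (p : List α) (_ : T.output p = w), (p.length : ℕ∞)

end Transducer

/-- The real number with the base-`b` expansion `0.w000…`. -/
noncomputable def realOfWord (b : ℕ) [NeZero b] (w : List (Fin b)) : ℝ :=
  Real.ofDigits fun i => w.getD i 0

/-- The base-`b` `T`-information content of `x` at precision `δ`: the least `T`-information content
of a word `w` with `|0.w - x| < δ`, and `⊤` if `T` outputs no such word. -/
noncomputable def infoContentAt {b : ℕ} [NeZero b] (T : Transducer (Fin b)) (δ x : ℝ) : ℕ∞ :=
  ⨅ (w : List (Fin b)) (_ : |realOfWord b w - x| < δ), T.infoContent w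

/-- The base-`b` finite-state dimension of `x`: the infimum over all transducers `T` of the lower
limit, as `δ → 0⁺`, of the information content at precision `δ` divided by `log_b (1 / δ)`. -/
noncomputable def dimFS (b : ℕ) [NeZero b] (x : ℝ) : ℝ≥0∞ :=
  ⨅ T : Transducer (Fin b),
    Filter.liminf
      (fun δ : ℝ => (infoContentAt T δ x : ℝ≥0∞) / ENNReal.ofReal (Real.logb b (1 / δ)))
      (𝓝[>] (0 : ℝ))

/-- The base-`b` digit sequence of `x ∈ [0, 1)`. The two theorems below say that it represents `x`
and does not end in infinitely many digits `b - 1`. -/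
noncomputable def seqOf (b : ℕ) [NeZero b] (x : ℝ) : ℕ → Fin b :=
  Real.digits x b

theorem ofDigits_seqOf {b : ℕ} [NeZero b] (hb : 2 ≤ b) {x : ℝ} (hx : x ∈ Set.Ico (0 : ℝ) 1) :
    Real.ofDigits (seqOf b x) = x :=
  Real.ofDigits_digits hb hx

theorem seqOf_not_eventually_last {b : ℕ} [NeZero b] (hb : 2 ≤ b) {x : ℝ}
    (hx : x ∈ Set.Ico (0 : ℝ) 1) (n : ℕ) : ∃ i, n ≤ i ∧ (seqOf b x i : ℕ) ≠ b - 1 := by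
  by_contra! h
  have h1 := Real.ofDigits_eq_sum_add_ofDigits (seqOf b x) n
  have h2 : (fun i => seqOf b x (i + n)) =
      fun _ => (⟨b - 1, Nat.sub_one_lt_of_lt hb⟩ : Fin b) := by
    funext i
    exact Fin.ext (h (i + n) (by omega))
  rw [h2, Real.ofDigits_const_last_eq_one' hb, ofDigits_seqOf hb hx] at h1
  have h3 := Real.ofDigits_digits_sum_eq (b := b) hx n
  have h4 := Nat.lt_floor_add_one ((b : ℝ) ^ n * x)
  have hb0 : (0 : ℝ) < (b : ℝ) ^ n := by
    have := NeZero.pos b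
    positivity
  have h5 : (b : ℝ) ^ n * x =
      (b : ℝ) ^ n * ∑ i ∈ Finset.range n, Real.ofDigitsTerm (seqOf b x) i + 1 := by
    conv_lhs => rw [h1]
    field_simp
  rw [← h3] at h4
  exact absurd h5 h4.ne

/-- The number of positions `i < n` at which the word `w` occurs in the sequence `S`. -/
noncomputable def occurrences {α : Type} (S : ℕ → α) (w : List α) (n : ℕ) : ℕ :=
  {i : ℕ | i < n ∧ (List.range w.length).map (fun j => S (i + j)) = w}.ncard

/-- `x` is Borel normal in base `b`: every word `w` of base-`b` digits occurs in the base-`b`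
expansion of `x` with asymptotic frequency `b ^ (-|w|)`. -/
def IsNormal (b : ℕ) [NeZero b] (x : ℝ) : Prop :=
  ∀ w : List (Fin b),
    Filter.Tendsto (fun n : ℕ => (occurrences (seqOf b x) w n : ℝ) / (n : ℝ)) Filter.atTop
      (𝓝 (((b : ℝ) ^ w.length)⁻¹))

end FSDim

/-! Both directions compare counting with frequencies of words.

Normal implies dimension at least 1. From a given state, inputs of length at most `l` produce few
words of length `m = l + d`: up to a constant, `b ^ l` out of `b ^ m`. In a normal sequence such
compressible words fill only a small fraction of the windows of length `m`, and every other window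
costs at least `l` input symbols. Summing this cost over all windows, overlapping ones included,
counts each input symbol at most `m` times, so a prefix of length `n` needs an input of length about
`n` (`length_mul_incompressible_le`, `eventually_le_length`). Sliding windows match the definition
of normality directly, so no aligned-block version of normality is needed. Since carries can make
close reals differ in all late digits, closeness to `x` is turned into a common prefix at an
occurrence of the digits `01` (`prefix_of_abs_sub_lt`), which normality supplies just before
position `n`.

Not normal implies dimension less than 1. Some word `w` has a frequency that is off by `ε`
infinitely often. By Chebyshev's inequality few words of length `M` have a deviant number of
occurrences of `w` (`card_deviant_mul_sq_le`), so they can be coded with `d` symbols fewer, at the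
price of one flag digit per block. A deviation in a long prefix makes a fixed proportion of its
blocks deviant (`deviation_le`), and for large `d` the saving exceeds the flags.

The bound `dimFS b x ≤ 1` comes from copying the input. -/

namespace FSDim

open Filter Finset

/-! ### Occurrences as sums of indicators -/

/-- The word `w` occurs in the sequence `S` at position `i`. -/
def OccursAt {α : Type} (S : ℕ → α) (w : List α) (i : ℕ) : Prop :=
  (List.range w.length).map (fun j => S (i + j)) = w

theorem occursAt_iff {α : Type} {S : ℕ → α} {w : List α} {i : ℕ} :
    OccursAt S w i ↔ ∀ (j : ℕ) (h : j < w.length), S (i + j) = w[j] := by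
  unfold OccursAt
  constructor
  · intro h j hj
    have := List.getElem_of_eq h (i := j) (by simpa using hj)
    simpa using this
  · intro h
    apply List.ext_getElem (by simp)
    intro j h1 h2
    simpa using h j h2

open Classical in
/-- The indicator of the occurrence of `w` in `S` at position `i`. -/
noncomputable def occInd {α : Type} (S : ℕ → α) (w : List α) (i : ℕ) : ℝ :=
  if OccursAt S w i then 1 else 0

theorem occInd_nonneg {α : Type} (S : ℕ → α) (w : List α) (i : ℕ) : 0 ≤ occInd S w i := by
  unfold occInd; split_ifs <;> norm_num

theorem occInd_le_one {α : Type} (S : ℕ → α) (w : List α) (i : ℕ) : occInd S w i ≤ 1 := by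
  unfold occInd; split_ifs <;> norm_num

theorem occurrences_eq_sum {α : Type} (S : ℕ → α) (w : List α) (n : ℕ) :
    (occurrences S w n : ℝ) = ∑ i ∈ range n, occInd S w i := by
  classical
  have : {i : ℕ | i < n ∧ (List.range w.length).map (fun j => S (i + j)) = w} =
      ((range n).filter (OccursAt S w) : Finset ℕ) := by
    ext i; simp [OccursAt]
  rw [occurrences, this, Set.ncard_coe_finset, Finset.card_filter]
  simp [occInd]

/-! ### Close reals and common prefixes -/

/-- The integer whose base-`b` digits are the first `n` terms of `d`. -/
def prefixNat {b : ℕ} (d : ℕ → Fin b) : ℕ → ℕ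
  | 0 => 0
  | n + 1 => b * prefixNat d n + d n

theorem pow_mul_sum_ofDigitsTerm {b : ℕ} [NeZero b] (d : ℕ → Fin b) (n : ℕ) :
    (b : ℝ) ^ n * ∑ i ∈ range n, Real.ofDigitsTerm d i = prefixNat d n := by
  have hb : (b : ℝ) ≠ 0 := by exact_mod_cast NeZero.ne b
  induction n with
  | zero => simp [prefixNat]
  | succ n ih =>
    rw [sum_range_succ, mul_add, pow_succ', mul_assoc, ih, Real.ofDigitsTerm, prefixNat]
    push_cast
    field_simp
    ring

theorem pow_mul_ofDigits {b : ℕ} [NeZero b] (d : ℕ → Fin b) (n : ℕ) :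
    (b : ℝ) ^ n * Real.ofDigits d = prefixNat d n + Real.ofDigits fun i => d (i + n) := by
  have hb : (b : ℝ) ≠ 0 := by exact_mod_cast NeZero.ne b
  rw [Real.ofDigits_eq_sum_add_ofDigits d n, mul_add, pow_mul_sum_ofDigitsTerm]
  field_simp

theorem eq_of_prefixNat_eq {b : ℕ} {d e : ℕ → Fin b} {n : ℕ}
    (h : prefixNat d n = prefixNat e n) : ∀ i < n, d i = e i := by
  induction n with
  | zero => simp
  | succ n ih =>
    simp only [prefixNat] at h
    have hb : 0 < b := Fin.pos (d 0)
    have h1 : (d n : ℕ) = e n := by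
      have := congrArg (· % b) h
      simpa [Nat.mod_eq_of_lt (d n).2, Nat.mod_eq_of_lt (e n).2] using this
    rw [h1] at h
    have h2 := ih (Nat.eq_of_mul_eq_mul_left hb (Nat.add_right_cancel h))
    intro i hi
    rcases Nat.lt_succ_iff_lt_or_eq.mp hi with h3 | rfl
    · exact h2 i h3
    · exact Fin.ext h1

theorem getElem?_of_getD_eq {b : ℕ} [NeZero b] {w : List (Fin b)} {i : ℕ} {a : Fin b}
    (hi : i < w.length) (h : w.getD i 0 = a) : w[i]? = some a := by
  rw [List.getD_eq_getElem _ _ hi] at h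
  rw [List.getElem?_eq_getElem hi, h]

/-- If the digits of `S` at positions `i` and `i + 1` are `0` and `1`, then a word whose value is
close to that of `S` agrees with `S` at all positions less than `i`. -/
theorem prefix_of_abs_sub_lt {b : ℕ} [NeZero b] (hb : 2 ≤ b) {S : ℕ → Fin b} {i : ℕ}
    (h0 : (S i : ℕ) = 0) (h1 : (S (i + 1) : ℕ) = 1) {w : List (Fin b)}
    (hw : |realOfWord b w - Real.ofDigits S| < ((b : ℝ) ^ (i + 2))⁻¹) :
    ∀ j < i, w[j]? = some (S j) := by
  have hb2 : (2 : ℝ) ≤ b := by exact_mod_cast hb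
  have hbi : (0 : ℝ) < (b : ℝ) ^ i := by positivity
  set d : ℕ → Fin b := fun i => w.getD i 0 with hd
  set t : ℝ := Real.ofDigits fun j => S (j + i + 2)
  have ht0 : 0 ≤ t := Real.ofDigits_nonneg _
  have ht1 : t ≤ 1 := Real.ofDigits_le_one _
  have eS : (b : ℝ) ^ i * Real.ofDigits S = prefixNat S i + ((b : ℝ) ^ 2)⁻¹ * (1 + t) := by
    rw [pow_mul_ofDigits]
    congr 1
    have h := pow_mul_ofDigits (fun j => S (j + i)) 2
    have e : prefixNat (fun j => S (j + i)) 2 = 1 := by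
      simp [prefixNat, h0, add_comm 1 i, h1]
    rw [e] at h
    have e2 : (fun j => S (j + 2 + i)) = fun j => S (j + i + 2) := by
      funext j; congr 1; omega
    rw [e2] at h
    rw [eq_inv_mul_iff_mul_eq₀ (by positivity), h]
    simp [t]
  have ed : (b : ℝ) ^ i * realOfWord b w = prefixNat d i + Real.ofDigits fun j => d (j + i) :=
    pow_mul_ofDigits d i
  have hu0 : 0 ≤ Real.ofDigits fun j => d (j + i) := Real.ofDigits_nonneg _
  have hu1 : (Real.ofDigits fun j => d (j + i)) ≤ 1 := Real.ofDigits_le_one _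
  have hclose : |(b : ℝ) ^ i * realOfWord b w - (b : ℝ) ^ i * Real.ofDigits S| <
      ((b : ℝ) ^ 2)⁻¹ := by
    rw [← mul_sub, abs_mul, abs_of_pos hbi]
    calc _ < (b : ℝ) ^ i * ((b : ℝ) ^ (i + 2))⁻¹ := by gcongr
      _ = _ := by rw [pow_add]; field_simp
  rw [eS, ed, abs_lt] at hclose
  have hinv : ((b : ℝ) ^ 2)⁻¹ ≤ 1 / 4 := by
    rw [inv_le_comm₀ (by positivity) (by norm_num)]
    nlinarith
  have hip : 0 < ((b : ℝ) ^ 2)⁻¹ := by positivity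
  -- The digits `01` put the fractional part of `b ^ i * Real.ofDigits S` between `b⁻²` and `2 b⁻² ≤
  -- 1/2`. An error below `b⁻² ≤ 1/4` therefore crosses no integer.
  have l1 : (prefixNat d i : ℝ) < prefixNat S i + 1 := by nlinarith
  have l2 : (prefixNat S i : ℝ) < prefixNat d i + 1 := by nlinarith
  have l3 : prefixNat d i = prefixNat S i := by
    have l1' : prefixNat d i < prefixNat S i + 1 := by exact_mod_cast l1
    have l2' : prefixNat S i < prefixNat d i + 1 := by exact_mod_cast l2
    omega
  -- Otherwise the scaled value of `w` would be the integer `prefixNat S i` itself, which the digit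
  -- `1` keeps at distance at least `b⁻²`.
  have hlen : i < w.length := by
    by_contra hc
    have hz : (Real.ofDigits fun j => d (j + i)) = 0 := by
      have : (fun j => d (j + i)) = fun _ => (0 : Fin b) := by
        funext j
        simp only [hd]
        exact List.getD_eq_default _ _ (by omega)
      rw [this]
      simp [Real.ofDigits, Real.ofDigitsTerm]
    rw [hz, l3] at hclose
    nlinarith
  intro j hj
  exact getElem?_of_getD_eq (by omega) (eq_of_prefixNat_eq l3 j hj)

/-- A word with positive asymptotic frequency occurs in every window `[(1 - η) n, n)`, for large
`n`. -/
theorem eventually_exists_occursAt {α : Type} {S : ℕ → α} {w : List α} {p : ℝ} (hp : 0 < p)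
    (h : Tendsto (fun n : ℕ => (occurrences S w n : ℝ) / (n : ℝ)) atTop (𝓝 p))
    {η : ℝ} (hη : 0 < η) (hη1 : η < 1) :
    ∀ᶠ n : ℕ in atTop, ∃ i < n, (1 - η) * n ≤ i ∧ OccursAt S w i := by
  have hc : Tendsto (fun n : ℕ => ⌈(1 - η) * (n : ℝ)⌉₊) atTop atTop := by
    refine tendsto_nat_ceil_atTop.comp ?_
    exact tendsto_natCast_atTop_atTop.const_mul_atTop (by linarith)
  -- The count up to `⌈(1 - η) n⌉`, divided by `n`, tends to `p (1 - η) < p`, so the count up to `n`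
  -- is eventually larger.
  have h2 := (h.comp hc).mul ((tendsto_nat_ceil_mul_div_atTop (R := ℝ) (a := 1 - η)
    (by linarith)).comp tendsto_natCast_atTop_atTop)
  have hlt : p * (1 - η) < p := by nlinarith
  filter_upwards [h2.eventually_lt h hlt, eventually_gt_atTop 0,
    hc.eventually (eventually_gt_atTop 0)] with n hn hn0 hcn
  by_contra hcon
  push Not at hcon
  have hn0' : (0 : ℝ) < n := by exact_mod_cast hn0
  have hcn' : (0 : ℝ) < (⌈(1 - η) * (n : ℝ)⌉₊ : ℝ) := by exact_mod_cast hcn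
  simp only [Function.comp] at hn
  rw [div_mul_div_cancel₀ hcn'.ne', div_lt_div_iff_of_pos_right hn0', Nat.cast_lt] at hn
  refine absurd hn (not_lt.mpr ?_)
  unfold occurrences
  refine Set.ncard_le_ncard ?_ ((Set.finite_lt_nat _).subset fun i hi => hi.1)
  rintro i ⟨hi, hi2⟩
  refine ⟨?_, hi2⟩
  by_contra hi3
  exact hcon i hi (Nat.ceil_le.mp (not_lt.mp hi3)) hi2

/-! ### Compressible words and the input length for a prefix -/

namespace Transducer

variable {α : Type}

theorem outputFrom_append (T : Transducer α) (q : T.Q) (u v : List α) :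
    T.outputFrom q (u ++ v) = T.outputFrom q u ++ T.outputFrom (T.run q u) v := by
  induction u generalizing q with
  | nil => simp [outputFrom, run]
  | cons a u ih => simp [outputFrom, run, ih]

theorem exists_length_out_le [Finite α] (T : Transducer α) :
    ∃ c, ∀ q a, (T.out q a).length ≤ c := by
  have := T.finite_states
  obtain ⟨c, hc⟩ := (Set.finite_range fun x : T.Q × α => (T.out x.1 x.2).length).bddAbove
  exact ⟨c, fun q a => hc ⟨(q, a), rfl⟩⟩

/-- The words of length `m` that occur in an output on at most `l` symbols, at a position at most
`c`, lie in a small set. -/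
theorem exists_compressible {b : ℕ} [NeZero b] (T : Transducer (Fin b)) (c m l : ℕ) :
    ∃ C : Finset (List (Fin b)), C.card ≤ Nat.card T.Q * ((c + 1) * b ^ l) ∧
      (∀ u ∈ C, u.length = m) ∧
      ∀ q j p, j ≤ c → p.length ≤ l → j + m ≤ (T.outputFrom q p).length →
        ((T.outputFrom q p).drop j).take m ∈ C := by
  classical
  have := T.finite_states
  have := Fintype.ofFinite T.Q
  let f : T.Q × Fin (c + 1) × (Fin l → Fin b) → List (Fin b) := fun x =>
    ((T.outputFrom x.1 (List.ofFn x.2.2)).drop x.2.1).take m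
  refine ⟨(univ.image f).filter (·.length = m), ?_, by simp, ?_⟩
  · refine (card_filter_le _ _).trans (card_image_le.trans ?_)
    simp [Nat.card_eq_fintype_card]
  · intro q j p hj hp hm
    -- Padding the input to length exactly `l` only appends to the output, so the extracted word is
    -- unchanged and inputs of one length suffice for the count.
    have hlen : (p ++ List.replicate (l - p.length) 0).length = l := by simp; omega
    rw [mem_filter]
    refine ⟨mem_image.mpr ⟨(q, ⟨j, by omega⟩,
      fun i => (p ++ List.replicate (l - p.length) 0)[i.1]'(by rw [hlen]; exact i.2)),
      mem_univ _, ?_⟩, ?_⟩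
    · have e : (List.ofFn fun i : Fin l =>
          (p ++ List.replicate (l - p.length) (0 : Fin b))[i.1]'(by rw [hlen]; exact i.2)) =
          p ++ List.replicate (l - p.length) 0 :=
        List.ext_getElem (by simp [hlen]) (fun i h1 h2 => by simp)
      simp only [f]
      rw [e, outputFrom_append, List.drop_append_of_le_length (by omega),
        List.take_append_of_le_length (by simp; omega)]
    · simp; omega

end Transducer

/-- The differences `τ (i + m) - τ i` telescope: only the `m` terms beyond `K` can add to the sum.
-/
theorem sum_shift_le {τ : ℕ → ℕ} {A : ℕ} (h : ∀ i, τ i ≤ A) (K m : ℕ) :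
    ∑ i ∈ range K, τ (i + m) ≤ ∑ i ∈ range K, τ i + m * A := by
  have h1 := sum_range_add τ m K
  have h2 := sum_range_add τ K m
  rw [add_comm K m] at h2
  have h3 : ∑ i ∈ range m, τ (K + i) ≤ m * A := by
    simpa using sum_le_card_nsmul (range m) (fun i => τ (K + i)) A fun i _ => h _
  simp only [add_comm _ m]
  omega

/-- If `T` outputs a word starting with `n` terms of `S`, then the input is long unless many
subwords of `S` of length `m` are compressible. -/
theorem length_mul_incompressible_le {α : Type} [DecidableEq α] {T : Transducer α} {c m l : ℕ} (hm : 0 < m)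
    (hc : ∀ q a, (T.out q a).length ≤ c) {C : Finset (List α)}
    (hC : ∀ q j p, j ≤ c → p.length ≤ l → j + m ≤ (T.outputFrom q p).length →
        ((T.outputFrom q p).drop j).take m ∈ C)
    {S : ℕ → α} {n K : ℕ} (hK : K + m ≤ n) {p : List α}
    (hp : ∀ i < n, (T.output p)[i]? = some (S i)) :
    l * {i ∈ range K | (List.range m).map (fun j => S (i + j)) ∉ C}.card ≤ m * p.length := by
  set P : ℕ → ℕ := fun t => (T.output (p.take t)).length with hP
  -- `τ i` is the number of input symbols that can be read with at most `i` symbols put out. If any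
  -- input remains, the next symbol emits the output at position `i`.
  set τ : ℕ → ℕ := fun i => Nat.findGreatest (fun t => P t ≤ i) p.length with hτ
  have hτle : ∀ i, τ i ≤ p.length := fun i => Nat.findGreatest_le _
  have hmono : ∀ i, τ i ≤ τ (i + m) := fun i =>
    Nat.findGreatest_mono_left (fun t ht => le_trans ht (by omega)) _
  have hspec : ∀ i, P (τ i) ≤ i := fun i =>
    Nat.findGreatest_spec (P := fun t => P t ≤ i) (Nat.zero_le _)
      (by simp [hP, Transducer.output, Transducer.outputFrom])
  have hgt : ∀ i t, τ i < t → t ≤ p.length → i < P t := fun i t h1 h2 =>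
    not_le.mp (Nat.findGreatest_is_greatest (P := fun t => P t ≤ i) h1 h2)
  have hlen : ∀ i < n, i < (T.output p).length := fun i hi => by
    have := hp i hi
    rw [List.getElem?_eq_some_iff] at this
    exact this.1
  have hPlen : P p.length = (T.output p).length := by simp [hP]
  have key : ∀ i < K, (List.range m).map (fun j => S (i + j)) ∉ C → τ i + l ≤ τ (i + m) := by
    intro i hi hblock
    by_contra hlt
    apply hblock
    have hnlen : i + m ≤ (T.output p).length := by
      have := hlen (i + m - 1) (by omega)
      omega
    set t0 := τ i with ht0
    have ht0len : t0 < p.length := by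
      refine lt_of_le_of_ne (hτle i) fun h => ?_
      have := hspec i
      rw [← ht0, h, hPlen] at this
      omega
    -- A time by which the whole window has been put out: one symbol after `τ (i + m)`, or the end
    -- of the input.
    obtain ⟨t1, ht01, ht1len, ht1l, ht1⟩ :
        ∃ t1, t0 ≤ t1 ∧ t1 ≤ p.length ∧ t1 ≤ t0 + l ∧ i + m ≤ P t1 := by
      have := hmono i
      rcases (hτle (i + m)).lt_or_eq with h | h
      · exact ⟨τ (i + m) + 1, by omega, h, by omega, (hgt _ _ (Nat.lt_succ_self _) h).le⟩
      · exact ⟨p.length, by omega, le_rfl, by omega, by rw [hPlen]; omega⟩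
    have hsplit : p.take t1 = p.take t0 ++ (p.drop t0).take (t1 - t0) := by
      rw [← List.take_add]; congr 1; omega
    set q := T.run T.start (p.take t0)
    set s := (p.drop t0).take (t1 - t0)
    have ho1 : T.output (p.take t1) = T.output (p.take t0) ++ T.outputFrom q s := by
      rw [hsplit]; exact T.outputFrom_append _ _ _
    have ho : T.output p = T.output (p.take t1) ++
        T.outputFrom (T.run T.start (p.take t1)) (p.drop t1) := by
      conv_lhs => rw [← List.take_append_drop t1 p]
      exact T.outputFrom_append _ _ _
    have hsucc : P (t0 + 1) ≤ P t0 + c := by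
      simp only [hP]
      rw [List.take_succ_eq_append_getElem ht0len, Transducer.output, T.outputFrom_concat,
        List.length_append]
      exact Nat.add_le_add_left (hc _ _) _
    have h5 := hgt i (t0 + 1) (Nat.lt_succ_self _) ht0len
    have h6 : P t0 ≤ i := hspec i
    have h7 : P t1 = P t0 + (T.outputFrom q s).length := by
      simp only [hP]
      rw [ho1, List.length_append]
    -- The window starts inside the output of the single symbol read at time `t0`, hence at offset
    -- at most `c`.
    have hmem := hC q (i - P t0) s (by omega) (by simp [s]; omega) (by omega)
    convert hmem using 1
    apply List.ext_getElem
    · simp; omega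
    · intro j h1 h2
      have hj : j < m := by simpa using h1
      have h8 := hp (i + j) (by omega)
      rw [ho, ho1, List.append_assoc, List.getElem?_append_right (by simp only [hP] at h6; omega),
        List.getElem?_append_left (by simp only [hP] at h6 h7 ht1 ⊢; omega)] at h8
      rw [List.getElem?_eq_some_iff] at h8
      obtain ⟨h9, h10⟩ := h8
      simp only [List.getElem_map, List.getElem_range, List.getElem_take, List.getElem_drop]
      rw [← h10]
      congr 1
      simp only [hP] at h6 ⊢
      omega
  have h1 := sum_shift_le hτle K m
  have h2 : ∑ i ∈ range K, (τ i + if (List.range m).map (fun j => S (i + j)) ∉ C then l else 0) ≤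
      ∑ i ∈ range K, τ (i + m) := by
    refine sum_le_sum fun i hi => ?_
    by_cases h : (List.range m).map (fun j => S (i + j)) ∈ C
    · simpa [h] using hmono i
    · simpa [h] using key i (mem_range.mp hi) h
  rw [sum_add_distrib, ← sum_filter, sum_const, smul_eq_mul, mul_comm] at h2
  omega

/-- Exactly one word of length `m` starts at each position, so each position is counted once. -/
theorem card_not_mem_add_sum_occurrences {α : Type} [DecidableEq α] (S : ℕ → α) {m : ℕ} {C : Finset (List α)}
    (hC : ∀ u ∈ C, u.length = m) (K : ℕ) :
    ({i ∈ range K | (List.range m).map (fun j => S (i + j)) ∉ C}.card : ℝ) +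
      ∑ u ∈ C, (occurrences S u K : ℝ) = K := by
  simp only [occurrences_eq_sum]
  rw [sum_comm, card_filter]
  push_cast
  rw [← sum_add_distrib]
  have : ∀ i ∈ range K, ((if (List.range m).map (fun j => S (i + j)) ∉ C then (1 : ℝ) else 0) +
      ∑ u ∈ C, occInd S u i) = 1 := by
    intro i _
    have e : ∀ u ∈ C, occInd S u i =
        if (List.range m).map (fun j => S (i + j)) = u then 1 else 0 := by
      intro u hu
      simp only [occInd, OccursAt, hC u hu]
    rw [sum_congr rfl e, sum_ite_eq]
    split_ifs <;> simp_all
  rw [sum_congr rfl this]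
  simp

/-- Every transducer needs an input of length asymptotically at least `n` to output the first `n`
terms of a sequence whose words have the frequencies of a normal sequence. -/
theorem eventually_le_length {b : ℕ} [NeZero b] (hb : 2 ≤ b) {S : ℕ → Fin b}
    (hS : ∀ w : List (Fin b), Tendsto (fun n : ℕ => (occurrences S w n : ℝ) / (n : ℝ)) atTop
      (𝓝 (((b : ℝ) ^ w.length)⁻¹)))
    (T : Transducer (Fin b)) {ε : ℝ} (hε : 0 < ε) (hε1 : ε < 1) :
    ∀ᶠ n : ℕ in atTop, ∀ p, (∀ i < n, (T.output p)[i]? = some (S i)) →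
      (1 - ε) ^ 3 * n ≤ p.length := by
  have hb1 : (1 : ℝ) < b := by exact_mod_cast hb
  obtain ⟨c, hc⟩ := T.exists_length_out_le
  set D : ℝ := Nat.card T.Q * (c + 1)
  -- The compressible words number at most `D * b ^ l`. The choice of `d` makes this less than `ε *
  -- b ^ (l + d)`; then `l` is taken so large that `l / (l + d) ≥ 1 - ε`.
  obtain ⟨d, hd⟩ := pow_unbounded_of_one_lt (D / ε) hb1
  obtain ⟨l, hl⟩ := exists_nat_gt ((d + 1) / ε)
  have hl' : (d : ℝ) + 1 < l * ε := (div_lt_iff₀ hε).mp hl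
  have hl0 : 0 < l := by
    rcases Nat.eq_zero_or_pos l with rfl | h
    · simp at hl'; linarith [(Nat.cast_nonneg d : (0 : ℝ) ≤ d)]
    · exact h
  set m := l + d with hm
  obtain ⟨C, hCcard, hCm, hC⟩ := T.exists_compressible c m l
  have hlim : Tendsto (fun n : ℕ => ∑ u ∈ C, (occurrences S u n : ℝ) / (n : ℝ)) atTop
      (𝓝 (∑ u ∈ C, ((b : ℝ) ^ m)⁻¹)) :=
    tendsto_finsetSum _ fun u hu => by simpa [hCm u hu] using hS u
  have hlt : ∑ u ∈ C, ((b : ℝ) ^ m)⁻¹ < ε := by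
    rw [sum_const, nsmul_eq_mul, ← div_eq_mul_inv, div_lt_iff₀ (by positivity)]
    calc (C.card : ℝ) ≤ (Nat.card T.Q * ((c + 1) * b ^ l) : ℕ) := by exact_mod_cast hCcard
      _ = D * b ^ l := by push_cast; ring
      _ < (ε * b ^ d) * b ^ l := by
        rw [div_lt_iff₀ hε] at hd
        gcongr
        linarith
      _ = ε * b ^ m := by rw [hm, pow_add]; ring
  have hKlim : Tendsto (fun n : ℕ => n - m) atTop atTop := tendsto_sub_atTop_nat m
  obtain ⟨n0, hn0⟩ := exists_nat_gt (m / ε)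
  filter_upwards [hKlim.eventually (hlim.eventually_lt_const hlt),
    hKlim.eventually (eventually_gt_atTop 0), eventually_ge_atTop n0] with n hn hKpos hnn p hp
  have hKR : (0 : ℝ) < (n - m : ℕ) := by exact_mod_cast hKpos
  rw [← sum_div, div_lt_iff₀ hKR] at hn
  have h1 := length_mul_incompressible_le (by omega) hc hC (n := n) (K := n - m) (by omega) hp
  have h1' : (l : ℝ) * ({i ∈ range (n - m) |
      (List.range m).map (fun j => S (i + j)) ∉ C}.card : ℝ) ≤ m * p.length := by
    exact_mod_cast h1
  have h2 := card_not_mem_add_sum_occurrences S hCm (n - m)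
  set X : ℝ := ({i ∈ range (n - m) | (List.range m).map (fun j => S (i + j)) ∉ C}.card : ℝ)
  have h3 : (1 - ε) * (n - m : ℕ) ≤ X := by linarith
  have hmR : (m : ℝ) = l + d := by rw [hm]; push_cast; ring
  have hml : (1 - ε) * m ≤ l := by
    rw [hmR]
    nlinarith [(Nat.cast_nonneg d : (0 : ℝ) ≤ d)]
  have hmpos : (0 : ℝ) < m := by
    have : 0 < m := by omega
    exact_mod_cast this
  have hnm : (1 - ε) * n ≤ (n - m : ℕ) := by
    rw [Nat.cast_sub (by omega)]
    have : (m : ℝ) / ε < n := hn0.trans_le (by exact_mod_cast hnn)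
    rw [div_lt_iff₀ hε] at this
    linarith
  have he : 0 < 1 - ε := by linarith
  refine le_of_mul_le_mul_left ?_ hmpos
  -- The three factors pay for `l` against `m`, for the compressible windows, and for `n - m`
  -- against `n`.
  calc (m : ℝ) * ((1 - ε) ^ 3 * n) = ((1 - ε) * m) * ((1 - ε) * ((1 - ε) * n)) := by ring
    _ ≤ l * ((1 - ε) * (n - m : ℕ)) := by gcongr
    _ ≤ l * X := by gcongr
    _ ≤ _ := h1'

/-! ### Normal numbers have dimension at least one -/

theorem tendsto_logb_one_div {b : ℕ} (hb : 2 ≤ b) :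
    Tendsto (fun δ : ℝ => Real.logb b (1 / δ)) (𝓝[>] 0) atTop := by
  have hb1 : (1 : ℝ) < b := by exact_mod_cast hb
  simpa [Function.comp_def] using (Real.tendsto_logb_atTop hb1).comp
    (tendsto_inv_nhdsGT_zero (𝕜 := ℝ))

theorem le_infoContentAt {b : ℕ} [NeZero b] {T : Transducer (Fin b)} {δ x : ℝ} {k : ℕ}
    (h : ∀ p, |realOfWord b (T.output p) - x| < δ → k ≤ p.length) :
    (k : ℕ∞) ≤ infoContentAt T δ x := by
  refine le_iInf₂ fun w hw => le_iInf₂ fun p hp => ?_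
  subst hp
  exact_mod_cast h p hw

theorem infoContentAt_le {b : ℕ} [NeZero b] {T : Transducer (Fin b)} {δ x : ℝ}
    {p : List (Fin b)} (h : |realOfWord b (T.output p) - x| < δ) :
    infoContentAt T δ x ≤ p.length :=
  iInf₂_le_of_le (T.output p) h (iInf₂_le (f := fun q (_ : T.output q = T.output p) =>
    (q.length : ℕ∞)) p rfl)

theorem IsNormal.eventually_le_length {b : ℕ} [NeZero b] (hb : 2 ≤ b) {x : ℝ}
    (hx : x ∈ Set.Ico (0 : ℝ) 1) (h : IsNormal b x) (T : Transducer (Fin b)) {s : ℝ}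
    (hs0 : 0 < s) (hs : s < 1) :
    ∀ᶠ n : ℕ in atTop, ∀ p, |realOfWord b (T.output p) - x| < ((b : ℝ) ^ n)⁻¹ →
      s * n ≤ p.length := by
  -- Five factors `1 - ε` are lost: three for outputting a prefix, one for the position of the
  -- marker `01`, one for `n - 1` against `n`. Bernoulli's inequality gives `(1 - ε) ^ 5 ≥ 1 - 5 * ε
  -- = s`.
  set ε : ℝ := (1 - s) / 5 with hε
  have hε0 : 0 < ε := by rw [hε]; linarith
  have hε1 : ε < 1 := by rw [hε]; linarith
  have he : 0 < 1 - ε := by linarith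
  set w : List (Fin b) := [⟨0, by omega⟩, ⟨1, by omega⟩]
  have hp : (0 : ℝ) < ((b : ℝ) ^ w.length)⁻¹ := by
    have : 0 < b := by omega
    positivity
  obtain ⟨N1, hN1⟩ := eventually_atTop.mp (eventually_exists_occursAt hp (h w) hε0 hε1)
  obtain ⟨N2, hN2⟩ := eventually_atTop.mp (FSDim.eventually_le_length hb h T hε0 hε1)
  obtain ⟨N3, hN3⟩ := exists_nat_gt (N2 / (1 - ε))
  obtain ⟨N4, hN4⟩ := exists_nat_gt (1 / ε)
  filter_upwards [eventually_ge_atTop (N1 + 1), eventually_ge_atTop (N3 + 1),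
    eventually_ge_atTop (N4 + 1)] with n h1 h3 h4 p hpx
  -- Using `n - 1` gives `i + 2 ≤ n`, so precision `b ^ (-n)` suffices for the marker at `i`.
  obtain ⟨i, hin, hi, hocc⟩ := hN1 (n - 1) (by omega)
  rw [Nat.cast_sub (by omega), Nat.cast_one] at hi
  have hiN2 : N2 ≤ i := by
    have h5 : (N3 : ℝ) ≤ n - 1 := by
      have : ((N3 + 1 : ℕ) : ℝ) ≤ n := by exact_mod_cast h3
      push_cast at this; linarith
    rw [div_lt_iff₀ he] at hN3
    have : (N2 : ℝ) ≤ i := by nlinarith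
    exact_mod_cast this
  rw [occursAt_iff] at hocc
  have d0 := congrArg Fin.val (hocc 0 (by simp [w]))
  have d1 := congrArg Fin.val (hocc 1 (by simp [w]))
  simp only [w, List.getElem_cons_zero, List.getElem_cons_succ, add_zero] at d0 d1
  have hx' : Real.ofDigits (seqOf b x) = x := ofDigits_seqOf hb hx
  have hb1 : (1 : ℝ) ≤ b := by exact_mod_cast (by omega : 1 ≤ b)
  have hpre := prefix_of_abs_sub_lt hb d0 d1 (w := T.output p) (by
    rw [hx']
    refine hpx.trans_le ?_
    gcongr ?_⁻¹
    exact pow_le_pow_right₀ hb1 (by omega))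
  have h6 := hN2 i hiN2 p hpre
  have h7 : (1 - ε) * n ≤ n - 1 := by
    have : (N4 : ℝ) ≤ n := by exact_mod_cast (by omega : N4 ≤ n)
    rw [div_lt_iff₀ hε0] at hN4
    nlinarith
  have h8 : s ≤ (1 - ε) ^ 5 := by
    have := one_add_mul_le_pow (a := -ε) (by linarith) 5
    have e : (1 - ε) = 1 + -ε := by ring
    rw [e]
    refine le_trans (le_of_eq ?_) this
    rw [hε]; push_cast; ring
  calc s * n ≤ (1 - ε) ^ 5 * n := by gcongr
    _ = (1 - ε) ^ 3 * ((1 - ε) * ((1 - ε) * n)) := by ring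
    _ ≤ (1 - ε) ^ 3 * i := by
      gcongr
      exact le_trans (by gcongr) hi
    _ ≤ _ := h6

theorem IsNormal.one_le_dimFS {b : ℕ} [NeZero b] (hb : 2 ≤ b) {x : ℝ}
    (hx : x ∈ Set.Ico (0 : ℝ) 1) (h : IsNormal b x) : 1 ≤ dimFS b x := by
  have hb1 : (1 : ℝ) < b := by exact_mod_cast hb
  refine le_iInf fun T => le_of_forall_lt_imp_le_of_dense fun c hc => ?_
  refine le_liminf_of_le (h := ?_)
  set r := c.toReal
  have hcr : c = ENNReal.ofReal r := (ENNReal.ofReal_toReal hc.ne_top).symm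
  have hr0 : 0 ≤ r := ENNReal.toReal_nonneg
  have hr1 : r < 1 := by
    simpa using (ENNReal.toReal_lt_toReal hc.ne_top ENNReal.one_ne_top).mpr hc
  set s := (r + 1) / 2 with hs
  have hy := tendsto_logb_one_div hb
  have hev := h.eventually_le_length hb hx T (s := s) (by rw [hs]; linarith)
    (by rw [hs]; linarith)
  -- With `y = log_b (1 / δ)`, the bound `s * ⌊y⌋ ≥ s * (y - 1)` is at least `r * y` once `y ≥ s /
  -- (s - r)`.
  filter_upwards [(tendsto_nat_floor_atTop.comp hy).eventually hev,
    hy.eventually (eventually_gt_atTop 0), hy.eventually (eventually_ge_atTop (s / (s - r))),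
    self_mem_nhdsWithin] with δ hδ hy0 hyl hδ0
  simp only [Function.comp] at hδ
  set y := Real.logb b (1 / δ) with hyd
  have hδn : δ ≤ ((b : ℝ) ^ ⌊y⌋₊)⁻¹ := by
    have h1 : ((⌊y⌋₊ : ℕ) : ℝ) ≤ y := Nat.floor_le hy0.le
    rw [hyd, Real.le_logb_iff_rpow_le hb1 (one_div_pos.mpr hδ0), Real.rpow_natCast] at h1
    rw [le_inv_comm₀ hδ0 (by positivity)]
    simpa [hyd] using h1
  have hK : ((⌈s * ⌊y⌋₊⌉₊ : ℕ) : ℕ∞) ≤ infoContentAt T δ x :=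
    le_infoContentAt fun p hp => Nat.ceil_le.mpr (hδ p (hp.trans_le hδn))
  have hK' : ((⌈s * ⌊y⌋₊⌉₊ : ℕ) : ℝ≥0∞) ≤ (infoContentAt T δ x : ℝ≥0∞) := by
    have := ENat.toENNReal_le.mpr hK
    simpa using this
  rw [ENNReal.le_div_iff_mul_le (Or.inl (by simpa using hy0)) (Or.inl ENNReal.ofReal_ne_top)]
  refine le_trans ?_ hK'
  rw [hcr, ← ENNReal.ofReal_mul hr0, ← ENNReal.ofReal_natCast]
  refine ENNReal.ofReal_le_ofReal (le_trans ?_ (Nat.le_ceil _))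
  have h2 := Nat.lt_floor_add_one y
  rw [div_le_iff₀ (by rw [hs]; linarith)] at hyl
  have hs0 : 0 < s := by rw [hs]; linarith
  nlinarith

/-! ### Upper bounds on the dimension from compressed prefixes -/

/-- The word formed by the first `n` terms of the sequence `S`. -/
def prefixWord {α : Type} (S : ℕ → α) (n : ℕ) : List α :=
  (List.range n).map S

theorem abs_realOfWord_prefixWord_sub_le {b : ℕ} [NeZero b] (S : ℕ → Fin b) (n : ℕ) :
    |realOfWord b (prefixWord S n) - Real.ofDigits S| ≤ ((b : ℝ) ^ n)⁻¹ := by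
  refine Real.abs_ofDigits_sub_ofDigits_le fun i hi => ?_
  simp [prefixWord, List.getD_eq_getElem?_getD, hi]

/-- The dimension is bounded by the compression ratio of a transducer on infinitely many
prefixes. -/
theorem dimFS_le_of_frequently {b : ℕ} [NeZero b] (hb : 2 ≤ b) {x : ℝ}
    (hx : x ∈ Set.Ico (0 : ℝ) 1) (T : Transducer (Fin b)) {c c' : ℝ} (hc0 : 0 ≤ c) (hc : c < c')
    (h : ∃ᶠ n : ℕ in atTop, ∃ p, T.output p = prefixWord (seqOf b x) n ∧ p.length ≤ c * n) :
    dimFS b x ≤ ENNReal.ofReal c' := by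
  have hb1 : (1 : ℝ) < b := by exact_mod_cast hb
  refine (iInf_le _ T).trans (liminf_le_of_frequently_le' ?_)
  -- A prefix of length `n` has error at most `b ^ (-n)`, while strict closeness is required, hence
  -- the exponent `n - 1`. The gap between `c` and `c'` absorbs this shift.
  have hδ : Tendsto (fun n : ℕ => ((b : ℝ) ^ (n - 1))⁻¹) atTop (𝓝[>] 0) := by
    refine tendsto_nhdsWithin_iff.mpr ⟨?_, Eventually.of_forall fun n => ?_⟩
    · exact (tendsto_inv_atTop_zero.comp (tendsto_pow_atTop_atTop_of_one_lt hb1)).comp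
        (tendsto_sub_atTop_nat 1)
    · simp only [Set.mem_Ioi]; positivity
  refine hδ.frequently ?_
  obtain ⟨N, hN⟩ := exists_nat_gt (c' / (c' - c))
  refine (h.and_eventually (eventually_ge_atTop (N + 2))).mono ?_
  rintro n ⟨⟨p, hp, hpl⟩, hn⟩
  have hy : Real.logb b (1 / ((b : ℝ) ^ (n - 1))⁻¹) = (n : ℝ) - 1 := by
    rw [one_div, inv_inv, ← Real.rpow_natCast, Real.logb_rpow (by linarith) hb1.ne',
      Nat.cast_sub (by omega), Nat.cast_one]
  rw [hy]
  have hn2 : ((N + 2 : ℕ) : ℝ) ≤ n := by exact_mod_cast hn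
  push_cast at hn2
  have hclose : |realOfWord b (T.output p) - x| < ((b : ℝ) ^ (n - 1))⁻¹ := by
    have := abs_realOfWord_prefixWord_sub_le (seqOf b x) n
    rw [ofDigits_seqOf hb hx] at this
    rw [hp]
    refine this.trans_lt ?_
    gcongr ?_⁻¹
    exact pow_lt_pow_right₀ hb1 (by omega)
  have hK : (infoContentAt T ((b : ℝ) ^ (n - 1))⁻¹ x : ℝ≥0∞) ≤ (p.length : ℝ≥0∞) := by
    simpa using ENat.toENNReal_le.mpr (infoContentAt_le hclose)
  refine ENNReal.div_le_of_le_mul (hK.trans ?_)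
  rw [← ENNReal.ofReal_mul (by linarith), ← ENNReal.ofReal_natCast]
  refine ENNReal.ofReal_le_ofReal (hpl.trans ?_)
  rw [div_lt_iff₀ (by linarith)] at hN
  nlinarith

/-- The transducer that copies its input. -/
def copyTransducer (α : Type) : Transducer α where
  Q := Unit
  finite_states := inferInstance
  next := fun _ _ => ()
  out := fun _ a => [a]
  start := ()

theorem copyTransducer_output {α : Type} (w : List α) : (copyTransducer α).output w = w := by
  have : ∀ q, (copyTransducer α).outputFrom q w = w := by
    induction w with
    | nil => intro q; rfl
    | cons a w ih => intro q; simp [Transducer.outputFrom, ih]; rfl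
  exact this _

theorem dimFS_le_one {b : ℕ} [NeZero b] (hb : 2 ≤ b) {x : ℝ} (hx : x ∈ Set.Ico (0 : ℝ) 1) :
    dimFS b x ≤ 1 := by
  refine ENNReal.le_of_forall_pos_le_add fun ε hε _ => ?_
  have := dimFS_le_of_frequently hb hx (copyTransducer (Fin b)) (c := 1) (c' := 1 + ε)
    zero_le_one (by simpa using hε) (Frequently.of_forall fun n =>
      ⟨prefixWord (seqOf b x) n, copyTransducer_output _, by simp [prefixWord]⟩)
  rwa [ENNReal.ofReal_add zero_le_one ε.coe_nonneg, ENNReal.ofReal_one, ENNReal.ofReal_coe_nnreal] at this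

/-! ### Second moment bound for the number of occurrences in words of length `M` -/

/-- The sequence that begins with the word `u` and continues with zeros. -/
def extendZero {b M : ℕ} [NeZero b] (u : Fin M → Fin b) (i : ℕ) : Fin b :=
  if h : i < M then u ⟨i, h⟩ else 0

theorem card_filter_forall_mem_eq {b M : ℕ} (A : Finset (Fin M)) (v : Fin M → Fin b) :
    (univ.filter fun u : Fin M → Fin b => ∀ t ∈ A, u t = v t).card = b ^ (M - A.card) := by
  classical
  have e : (univ.filter fun u : Fin M → Fin b => ∀ t ∈ A, u t = v t) =
      Fintype.piFinset fun t => if t ∈ A then {v t} else univ := by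
    ext u
    simp only [mem_filter, mem_univ, true_and, Fintype.mem_piFinset]
    refine forall_congr' fun t => ?_
    by_cases h : t ∈ A <;> simp [h]
  rw [e, Fintype.card_piFinset]
  have : ∀ t, (if t ∈ A then ({v t} : Finset (Fin b)) else univ).card =
      if t ∈ A then 1 else b := by
    intro t; split_ifs <;> simp
  simp only [this]
  rw [prod_ite]
  simp [filter_not, card_sdiff]

/-- The positions covered by a word of length `k` starting at `i`. -/
def window (M k i : ℕ) : Finset (Fin M) :=
  univ.filter fun t => i ≤ t.1 ∧ t.1 < i + k

theorem card_window {M k i : ℕ} (h : i + k ≤ M) : (window M k i).card = k := by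
  have : (window M k i).map Fin.valEmbedding = Ico i (i + k) := by
    ext t
    simp only [window, Finset.mem_map, mem_filter, mem_univ, true_and, Fin.valEmbedding_apply, mem_Ico]
    constructor
    · rintro ⟨s, hs, rfl⟩; exact hs
    · intro ht; exact ⟨⟨t, by omega⟩, ht, rfl⟩
  rw [← card_map, this]
  simp

theorem occursAt_extendZero_iff {b M : ℕ} [NeZero b] (u : Fin M → Fin b) (w : List (Fin b))
    {i : ℕ} (hi : i + w.length ≤ M) :
    OccursAt (extendZero u) w i ↔
      ∀ t ∈ window M w.length i, u t = w.getD (t.1 - i) 0 := by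
  rw [occursAt_iff]
  constructor
  · intro h t ht
    simp only [window, mem_filter, mem_univ, true_and] at ht
    have := h (t.1 - i) (by omega)
    rw [List.getD_eq_getElem _ _ (by omega), ← this]
    simp [extendZero, Nat.add_sub_cancel' ht.1]
  · intro h j hj
    have := h ⟨i + j, by omega⟩ (by simp [window]; omega)
    simp only [Nat.add_sub_cancel_left] at this
    rw [List.getD_eq_getElem _ _ hj] at this
    rw [← this, extendZero, dif_pos]

theorem sum_occInd_extendZero {b M : ℕ} [NeZero b] (w : List (Fin b)) {i : ℕ}
    (hi : i + w.length ≤ M) :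
    ∑ u : Fin M → Fin b, occInd (extendZero u) w i = (b : ℝ) ^ M * ((b : ℝ) ^ w.length)⁻¹ := by
  classical
  have hb : (b : ℝ) ≠ 0 := by exact_mod_cast NeZero.ne b
  simp only [occInd, occursAt_extendZero_iff _ w hi]
  rw [sum_boole, card_filter_forall_mem_eq _ fun t : Fin M => w.getD (t.1 - i) 0,
    card_window hi]
  push_cast
  rw [pow_sub₀ _ hb (by omega)]

theorem sum_occInd_mul_occInd_extendZero {b M : ℕ} [NeZero b] (w : List (Fin b)) {i j : ℕ}
    (hij : i + w.length ≤ j) (hj : j + w.length ≤ M) :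
    ∑ u : Fin M → Fin b, occInd (extendZero u) w i * occInd (extendZero u) w j =
      (b : ℝ) ^ M * (((b : ℝ) ^ w.length)⁻¹ * ((b : ℝ) ^ w.length)⁻¹) := by
  classical
  have hb : (b : ℝ) ≠ 0 := by exact_mod_cast NeZero.ne b
  have hdisj : Disjoint (window M w.length i) (window M w.length j) := by
    rw [disjoint_left]
    intro t h1 h2
    simp only [window, mem_filter, mem_univ, true_and] at h1 h2
    omega
  -- As the windows are disjoint, both occurrences together prescribe the digits on their union by
  -- one function, and the number of free digits can be counted.
  have e : ∀ u : Fin M → Fin b, occInd (extendZero u) w i * occInd (extendZero u) w j =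
      if ∀ t ∈ window M w.length i ∪ window M w.length j,
        u t = if t.1 < j then w.getD (t.1 - i) 0 else w.getD (t.1 - j) 0 then 1 else 0 := by
    intro u
    simp only [occInd, occursAt_extendZero_iff u w (show i + w.length ≤ M by omega),
      occursAt_extendZero_iff u w hj]
    rw [ite_zero_mul_ite_zero, mul_one]
    refine if_congr ?_ rfl rfl
    simp only [mem_union, or_imp, forall_and]
    refine and_congr (forall₂_congr fun t ht => ?_) (forall₂_congr fun t ht => ?_)
    · simp only [window, mem_filter, mem_univ, true_and] at ht
      rw [if_pos (by omega)]
    · simp only [window, mem_filter, mem_univ, true_and] at ht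
      rw [if_neg (by omega)]
  simp only [e]
  rw [sum_boole, card_filter_forall_mem_eq _ fun t : Fin M =>
    if t.1 < j then w.getD (t.1 - i) 0 else w.getD (t.1 - j) 0, card_union_of_disjoint hdisj,
    card_window hj, card_window (by omega)]
  push_cast
  rw [pow_sub₀ _ hb (by omega), pow_add, mul_inv]

theorem abs_occInd_sub_le {α : Type} (S : ℕ → α) (w : List α) (i : ℕ) {p : ℝ} (h0 : 0 ≤ p)
    (h1 : p ≤ 1) : |occInd S w i - p| ≤ 1 := by
  have := occInd_nonneg S w i
  have := occInd_le_one S w i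
  rw [abs_le]; constructor <;> linarith

theorem inv_pow_mem_unit {b : ℕ} [NeZero b] (k : ℕ) :
    0 ≤ ((b : ℝ) ^ k)⁻¹ ∧ ((b : ℝ) ^ k)⁻¹ ≤ 1 := by
  have : (1 : ℝ) ≤ b := by exact_mod_cast NeZero.one_le
  exact ⟨by positivity, inv_le_one_of_one_le₀ (one_le_pow₀ this)⟩

/-- The covariance sum of two occurrences vanishes when they do not overlap, and is bounded
otherwise. -/
theorem sum_covariance_le {b M : ℕ} [NeZero b] (w : List (Fin b)) {i j : ℕ}
    (hi : i + w.length ≤ M) (hj : j + w.length ≤ M) :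
    ∑ u : Fin M → Fin b, (occInd (extendZero u) w i - ((b : ℝ) ^ w.length)⁻¹) *
      (occInd (extendZero u) w j - ((b : ℝ) ^ w.length)⁻¹) ≤
      if i < j + w.length ∧ j < i + w.length then (b : ℝ) ^ M else 0 := by
  obtain ⟨hp0, hp1⟩ := inv_pow_mem_unit (b := b) w.length
  split_ifs with h
  · calc _ ≤ ∑ u : Fin M → Fin b, (1 : ℝ) := by
          refine sum_le_sum fun u _ => (le_abs_self _).trans ?_
          rw [abs_mul]
          exact mul_le_one₀ (abs_occInd_sub_le _ _ _ hp0 hp1) (abs_nonneg _)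
            (abs_occInd_sub_le _ _ _ hp0 hp1)
      _ = _ := by simp
  · set p := ((b : ℝ) ^ w.length)⁻¹
    have hprod : ∑ u : Fin M → Fin b, occInd (extendZero u) w i * occInd (extendZero u) w j =
        (b : ℝ) ^ M * (p * p) := by
      rcases le_or_gt (i + w.length) j with h1 | h1
      · exact sum_occInd_mul_occInd_extendZero w h1 hj
      · simp only [mul_comm (occInd _ w i)]
        exact sum_occInd_mul_occInd_extendZero w (by omega) hi
    have hexp : ∀ u : Fin M → Fin b, (occInd (extendZero u) w i - p) *
        (occInd (extendZero u) w j - p) = occInd (extendZero u) w i * occInd (extendZero u) w j -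
        p * occInd (extendZero u) w i - p * occInd (extendZero u) w j + p * p := by
      intro u; ring
    simp only [hexp]
    rw [sum_add_distrib, sum_sub_distrib, sum_sub_distrib, ← mul_sum, ← mul_sum, hprod,
      sum_occInd_extendZero w hi, sum_occInd_extendZero w hj]
    simp only [sum_const, card_univ, Fintype.card_fun, Fintype.card_fin, nsmul_eq_mul]
    push_cast
    refine le_of_eq ?_
    simp only [p]
    ring

/-- Expanding the square leaves covariances. For each `i`, at most `2 * w.length` positions `j`
overlap with it. -/
theorem sum_sq_deviation_le {b M L : ℕ} [NeZero b] (w : List (Fin b)) (hL : L + w.length ≤ M) :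
    ∑ u : Fin M → Fin b,
      (∑ i ∈ range L, (occInd (extendZero u) w i - ((b : ℝ) ^ w.length)⁻¹)) ^ 2 ≤
      2 * w.length * L * (b : ℝ) ^ M := by
  simp only [sq, sum_mul_sum]
  rw [sum_comm]
  calc _ ≤ ∑ i ∈ range L, 2 * w.length * (b : ℝ) ^ M := by
        refine sum_le_sum fun i hi => ?_
        rw [sum_comm]
        have hi := mem_range.mp hi
        calc _ ≤ ∑ j ∈ range L,
              (if i < j + w.length ∧ j < i + w.length then (b : ℝ) ^ M else 0) := by
              refine sum_le_sum fun j hj => sum_covariance_le w (by omega) ?_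
              have := mem_range.mp hj
              omega
          _ = ((range L).filter fun j => i < j + w.length ∧ j < i + w.length).card *
              (b : ℝ) ^ M := by rw [← sum_filter, sum_const, nsmul_eq_mul]
          _ ≤ (2 * w.length : ℕ) * (b : ℝ) ^ M := by
              gcongr
              refine (card_le_card (t := Ico (i + 1 - w.length) (i + w.length)) ?_).trans
                (by simp; omega)
              intro j hj
              simp only [mem_filter, mem_range] at hj
              simp only [mem_Ico]
              omega
          _ = _ := by push_cast; ring
    _ = _ := by rw [sum_const, card_range, nsmul_eq_mul]; ring

/-- The words of length `M` in which the number of occurrences of `w` deviates by at least `a`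
from its expected value. -/
noncomputable def deviant {b : ℕ} [NeZero b] (w : List (Fin b)) (M : ℕ) (a : ℝ) :
    Finset (Fin M → Fin b) := by
  classical
  exact univ.filter fun u => a ≤
    |∑ i ∈ range (M - w.length), (occInd (extendZero u) w i - ((b : ℝ) ^ w.length)⁻¹)|

theorem mem_deviant {b : ℕ} [NeZero b] {w : List (Fin b)} {M : ℕ} {a : ℝ} {u : Fin M → Fin b} :
    u ∈ deviant w M a ↔ a ≤
      |∑ i ∈ range (M - w.length), (occInd (extendZero u) w i - ((b : ℝ) ^ w.length)⁻¹)| := by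
  simp [deviant]

/-- Chebyshev's inequality for the uniform distribution on words of length `M`. -/
theorem card_deviant_mul_sq_le {b M : ℕ} [NeZero b] (w : List (Fin b)) (hM : w.length ≤ M)
    {a : ℝ} (ha : 0 ≤ a) :
    ((deviant w M a).card : ℝ) * a ^ 2 ≤ 2 * w.length * M * (b : ℝ) ^ M := by
  calc ((deviant w M a).card : ℝ) * a ^ 2 = ∑ u ∈ deviant w M a, a ^ 2 := by simp
    _ ≤ ∑ u ∈ deviant w M a, (∑ i ∈ range (M - w.length),
        (occInd (extendZero u) w i - ((b : ℝ) ^ w.length)⁻¹)) ^ 2 := by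
      refine sum_le_sum fun u hu => ?_
      rw [← sq_abs (∑ i ∈ range _, _)]
      have := mem_deviant.mp hu
      gcongr
    _ ≤ ∑ u : Fin M → Fin b, (∑ i ∈ range (M - w.length),
        (occInd (extendZero u) w i - ((b : ℝ) ^ w.length)⁻¹)) ^ 2 :=
      sum_le_sum_of_subset_of_nonneg (subset_univ _) fun _ _ _ => sq_nonneg _
    _ ≤ 2 * w.length * (M - w.length : ℕ) * (b : ℝ) ^ M := sum_sq_deviation_le w (by omega)
    _ ≤ _ := by gcongr; omega

/-! ### A block code read by a finite-state transducer -/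

/-- The length of the codeword that begins with `v`: a flag digit, followed by `min l M` digits if
the flag is zero and by `M` digits otherwise. -/
def codeLength {b : ℕ} [NeZero b] (l M : ℕ) (v : List (Fin b)) : ℕ :=
  if v.head? = some 0 then min l M + 1 else M + 1

/-- The word encoded by the codeword `v`. -/
def decode {b : ℕ} [NeZero b] (dec : List (Fin b) → List (Fin b)) (v : List (Fin b)) :
    List (Fin b) :=
  if v.head? = some 0 then dec v.tail else v.tail

/-- The minimum in `codeLength` serves this bound: it keeps unfinished codewords in a finite set of
states for every `l`. -/
theorem length_le_of_lt_codeLength {b : ℕ} [NeZero b] {l M : ℕ} {v : List (Fin b)}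
    (h : v.length < codeLength l M v) : v.length ≤ M := by
  unfold codeLength at h
  split_ifs at h <;> omega

/-- The transducer that reads a concatenation of codewords and outputs the words they encode. -/
def blockDecoder {b : ℕ} [NeZero b] (l M : ℕ) (dec : List (Fin b) → List (Fin b)) :
    Transducer (Fin b) where
  Q := {v : List (Fin b) // v.length ≤ M}
  finite_states := (List.finite_length_le (Fin b) M).to_subtype
  next := fun q a =>
    if h : (q.1 ++ [a]).length < codeLength l M (q.1 ++ [a]) then
      ⟨q.1 ++ [a], length_le_of_lt_codeLength h⟩
    else ⟨[], Nat.zero_le M⟩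
  out := fun q a =>
    if (q.1 ++ [a]).length < codeLength l M (q.1 ++ [a]) then []
    else decode dec (q.1 ++ [a])
  start := ⟨[], Nat.zero_le M⟩

/-- Induction on the unread part `s`, with `q` the part already stored. The target length depends on
the flag digit alone, so it does not change while further symbols are read. -/
theorem blockDecoder_codeword {b : ℕ} [NeZero b] {l M : ℕ} {dec : List (Fin b) → List (Fin b)}
    (s : List (Fin b)) (q : (blockDecoder l M dec).Q) (hs : s ≠ [])
    (h : (q.1 ++ s).length = codeLength l M (q.1 ++ s)) :
    (blockDecoder l M dec).outputFrom q s = decode dec (q.1 ++ s) ∧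
      (blockDecoder l M dec).run q s = (blockDecoder l M dec).start := by
  induction s generalizing q with
  | nil => exact absurd rfl hs
  | cons a s ih =>
    rcases eq_or_ne s [] with rfl | hs'
    · simp only [Transducer.outputFrom, Transducer.run, List.foldl, List.append_nil]
      exact ⟨if_neg h.not_lt, dif_neg h.not_lt⟩
    · have hassoc : q.1 ++ a :: s = (q.1 ++ [a]) ++ s := by simp
      have hhead : (q.1 ++ a :: s).head? = (q.1 ++ [a]).head? := by
        cases q.1 <;> simp
      have hcode : codeLength l M (q.1 ++ a :: s) = codeLength l M (q.1 ++ [a]) := by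
        simp only [codeLength, hhead]
      have hlt : (q.1 ++ [a]).length < codeLength l M (q.1 ++ [a]) := by
        rw [← hcode, ← h, hassoc, List.length_append (bs := s)]
        have := List.length_pos_iff.mpr hs'
        omega
      have hnext : (blockDecoder l M dec).next q a =
          ⟨q.1 ++ [a], length_le_of_lt_codeLength hlt⟩ := dif_pos hlt
      have hout : (blockDecoder l M dec).out q a = [] := if_pos hlt
      have := ih ⟨q.1 ++ [a], length_le_of_lt_codeLength hlt⟩ hs' (by simpa using h)
      rw [hassoc]
      simpa [Transducer.outputFrom, Transducer.run, hnext, hout] using this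

theorem blockDecoder_output_flatten {b : ℕ} [NeZero b] {l M : ℕ}
    {dec : List (Fin b) → List (Fin b)} (V : List (List (Fin b)))
    (hV : ∀ v ∈ V, v ≠ [] ∧ v.length = codeLength l M v) :
    (blockDecoder l M dec).output V.flatten = (V.map (decode dec)).flatten := by
  induction V with
  | nil => rfl
  | cons v V ih =>
    obtain ⟨h1, h2⟩ := hV v (by simp)
    obtain ⟨h3, h4⟩ := blockDecoder_codeword (dec := dec) v (blockDecoder l M dec).start h1 h2
    have ih' := ih fun v hv => hV v (List.mem_cons_of_mem _ hv)
    simp only [Transducer.output] at ih' ⊢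
    rw [List.flatten_cons, Transducer.outputFrom_append, h3, h4, ih']
    simp [blockDecoder]

/-- The `I`-th block of length `M` of the sequence `S`. -/
def block {α : Type} (S : ℕ → α) (M I : ℕ) (j : Fin M) : α :=
  S (I * M + j)

theorem flatten_blocks {α : Type} (S : ℕ → α) (M N : ℕ) :
    ((List.range N).map fun I => List.ofFn (block S M I)).flatten = prefixWord S (N * M) := by
  induction N with
  | zero => simp [prefixWord]
  | succ N ih =>
    rw [List.range_succ, List.map_append, List.flatten_append, ih, Nat.succ_mul]
    apply List.ext_getElem?
    intro i
    simp only [prefixWord, List.map_cons, List.map_nil, List.flatten_cons, List.flatten_nil,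
      List.append_nil]
    rw [List.range_add, List.map_append]
    congr 2
    apply List.ext_getElem <;> simp [block]

theorem exists_code {b M l : ℕ} [NeZero b] (G : Finset (Fin M → Fin b)) (hG : G.card ≤ b ^ l) :
    ∃ (enc : (Fin M → Fin b) → List (Fin b)) (dec : List (Fin b) → List (Fin b)),
      ∀ u ∈ G, (enc u).length = l ∧ dec (enc u) = List.ofFn u := by
  classical
  obtain ⟨e⟩ : Nonempty (G ↪ (Fin l → Fin b)) :=
    Function.Embedding.nonempty_of_card_le (by simpa using hG)
  let enc : (Fin M → Fin b) → List (Fin b) := fun u =>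
    if h : u ∈ G then List.ofFn (e ⟨u, h⟩) else []
  have henc : Set.InjOn enc G := by
    intro u hu v hv huv
    have hu' : u ∈ G := hu
    have hv' : v ∈ G := hv
    simp only [enc, dif_pos hu', dif_pos hv'] at huv
    simpa using e.injective (List.ofFn_injective huv)
  refine ⟨enc, fun v => List.ofFn (Function.invFunOn enc G v), fun u hu => ⟨?_, ?_⟩⟩
  · simp [enc, hu]
  · exact congrArg List.ofFn (henc.leftInvOn_invFunOn hu)

/-- If a set of words of length `M` has at most `b ^ (M - d)` elements, some transducer saves `d`
symbols on each block in this set, and spends one more symbol on each block. -/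
theorem exists_transducer_of_card_le {b M d : ℕ} [NeZero b] (hb : 2 ≤ b) (hd : d ≤ M)
    (G : Finset (Fin M → Fin b)) (hG : G.card ≤ b ^ (M - d)) :
    ∃ T : Transducer (Fin b), ∀ (S : ℕ → Fin b) (N : ℕ), ∃ p,
      T.output p = prefixWord S (N * M) ∧
      p.length + d * {I ∈ range N | block S M I ∈ G}.card = N * (M + 1) := by
  obtain ⟨enc, dec, h⟩ := exists_code G hG
  have h10 : (⟨1, by omega⟩ : Fin b) ≠ 0 := by
    intro h
    have := congrArg Fin.val h
    simp at this
  refine ⟨blockDecoder (M - d) M dec, fun S N => ?_⟩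
  let code : (Fin M → Fin b) → List (Fin b) := fun u =>
    if u ∈ G then 0 :: enc u else ⟨1, by omega⟩ :: List.ofFn u
  have hcode : ∀ u, code u ≠ [] ∧ (code u).length = codeLength (M - d) M (code u) := by
    intro u
    by_cases hu : u ∈ G
    · simp [code, hu, codeLength, (h u hu).1]
    · simp [code, hu, codeLength, h10]
  have hdecode : ∀ u, decode dec (code u) = List.ofFn u := by
    intro u
    by_cases hu : u ∈ G
    · simp [code, hu, decode, (h u hu).2]
    · simp [code, hu, decode, h10]
  have hlen : ∀ u, (code u).length + d * (if u ∈ G then 1 else 0) = M + 1 := by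
    intro u
    by_cases hu : u ∈ G
    · simp [code, hu, (h u hu).1]; omega
    · simp [code, hu]
  refine ⟨((List.range N).map fun I => code (block S M I)).flatten, ?_, ?_⟩
  · rw [blockDecoder_output_flatten _ (by
      intro v hv
      obtain ⟨I, _, rfl⟩ := List.mem_map.mp hv
      exact hcode _), ← flatten_blocks, List.map_map]
    simp only [Function.comp_def, hdecode]
  · have e : (((List.range N).map fun I => code (block S M I)).flatten).length =
        ∑ I ∈ range N, (code (block S M I)).length := by
      rw [List.length_flatten, List.map_map]
      rfl
    rw [e, card_filter, mul_sum, ← sum_add_distrib]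
    simp only [hlen]
    simp

/-! ### Numbers that are not normal have dimension less than one -/

theorem occInd_extendZero_block {b M : ℕ} [NeZero b] (S : ℕ → Fin b) (w : List (Fin b))
    (I : ℕ) {j : ℕ} (hj : j + w.length ≤ M) :
    occInd (extendZero (block S M I)) w j = occInd S w (I * M + j) := by
  have : OccursAt (extendZero (block S M I)) w j ↔ OccursAt S w (I * M + j) := by
    rw [occursAt_iff, occursAt_iff]
    refine forall₂_congr fun t ht => ?_
    rw [extendZero, dif_pos (by omega), block, ← add_assoc]
  by_cases h : OccursAt S w (I * M + j) <;> simp [occInd, this, h]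

theorem sum_range_mul_eq (f : ℕ → ℝ) (N M : ℕ) :
    ∑ i ∈ range (N * M), f i = ∑ I ∈ range N, ∑ j ∈ range M, f (I * M + j) := by
  induction N with
  | zero => simp
  | succ N ih => rw [Nat.succ_mul, sum_range_add, ih, sum_range_succ]

theorem abs_sum_range_le {f : ℕ → ℝ} (hf : ∀ i, |f i| ≤ 1) (n : ℕ) :
    |∑ i ∈ range n, f i| ≤ n := by
  refine (abs_sum_le_sum_abs _ _).trans ?_
  simpa using sum_le_card_nsmul (range n) (fun i => |f i|) 1 fun i _ => hf i

/-- A deviation of the number of occurrences of `w` in a prefix of `S` forces deviations in many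
blocks. -/
theorem deviation_le {b M : ℕ} [NeZero b] (S : ℕ → Fin b) (w : List (Fin b))
    (hM : w.length ≤ M) (hM0 : 0 < M) {a : ℝ} (n : ℕ) (ha : 0 ≤ a) :
    |(occurrences S w n : ℝ) - n * ((b : ℝ) ^ w.length)⁻¹| ≤
      (n / M : ℕ) * (a + w.length) +
        ({I ∈ range (n / M) | block S M I ∈ deviant w M a}.card : ℝ) * M + M := by
  obtain ⟨hp0, hp1⟩ := inv_pow_mem_unit (b := b) w.length
  set p := ((b : ℝ) ^ w.length)⁻¹ with hp
  set N := n / M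
  have hf : ∀ i, |occInd S w i - p| ≤ 1 := fun i => abs_occInd_sub_le S w i hp0 hp1
  have hsum : (occurrences S w n : ℝ) - n * p = ∑ i ∈ range n, (occInd S w i - p) := by
    rw [occurrences_eq_sum, sum_sub_distrib]; simp
  have hn : n = N * M + n % M := (Nat.div_add_mod' n M).symm
  have hblock : ∀ I, |∑ j ∈ range M, (occInd S w (I * M + j) - p)| ≤
      (a + w.length) + if block S M I ∈ deviant w M a then (M : ℝ) else 0 := by
    intro I
    split_ifs with h
    · have := abs_sum_range_le (fun i => hf (I * M + i)) M
      have : (0 : ℝ) ≤ w.length := Nat.cast_nonneg _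
      linarith
    · have h1 := not_le.mp (mt mem_deviant.mpr h)
      have e1 : ∑ i ∈ range (M - w.length), (occInd (extendZero (block S M I)) w i - p) =
          ∑ i ∈ range (M - w.length), (occInd S w (I * M + i) - p) := by
        refine sum_congr rfl fun i hi => ?_
        have := mem_range.mp hi
        rw [occInd_extendZero_block S w I (by omega)]
      rw [← hp, e1] at h1
      -- `deviant` ignores the last `w.length` starting positions, where `w` may run into the next
      -- block. Each of them contributes at most 1.
      have e2 : M = (M - w.length) + w.length := by omega
      conv_lhs => rw [e2]
      rw [sum_range_add, add_zero]
      refine (abs_add_le _ _).trans (add_le_add ?_ ?_)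
      · rw [← e2]; exact h1.le
      · exact abs_sum_range_le (fun i => hf _) _
  rw [hsum, hn, sum_range_add, sum_range_mul_eq]
  refine (abs_add_le _ _).trans (add_le_add ?_ ?_)
  · refine (abs_sum_le_sum_abs _ _).trans ((sum_le_sum fun I _ => hblock I).trans ?_)
    rw [sum_add_distrib, sum_const, ← sum_filter, sum_const, card_range, nsmul_eq_mul,
      nsmul_eq_mul]
  · refine (abs_sum_range_le (fun i => hf _) _).trans ?_
    exact_mod_cast (Nat.mod_lt n hM0).le

theorem dimFS_lt_one_of_not_isNormal {b : ℕ} [NeZero b] (hb : 2 ≤ b) {x : ℝ}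
    (hx : x ∈ Set.Ico (0 : ℝ) 1) (h : ¬ IsNormal b x) : dimFS b x < 1 := by
  have hb0 : (0 : ℝ) < b := by exact_mod_cast NeZero.pos b
  simp only [IsNormal, Metric.tendsto_atTop, Real.dist_eq] at h
  push Not at h
  obtain ⟨w, ε, hε, hdev⟩ := h
  -- At least `ε * N / 4` of the `N` blocks will be deviant, so `d > 8 / ε` saves `2 * N` symbols
  -- against `N` flags. `M1` makes the boundary loss `w.length` at most `ε * M / 4`, and `M2` makes
  -- the Chebyshev bound at most `b ^ (M - d)`.
  obtain ⟨d, hd⟩ := exists_nat_gt (8 / ε)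
  obtain ⟨M1, hM1⟩ := exists_nat_gt (4 * w.length / ε)
  obtain ⟨M2, hM2⟩ := exists_nat_gt (32 * w.length * (b : ℝ) ^ d / ε ^ 2)
  set M := d + w.length + M1 + M2 + 1 with hM
  have hMpos : (0 : ℝ) < M := by positivity
  have hM1' : (w.length : ℝ) ≤ ε * M / 4 := by
    rw [div_lt_iff₀ hε] at hM1
    have : (M1 : ℝ) ≤ M := by exact_mod_cast (by omega : M1 ≤ M)
    nlinarith
  have hM2' : 32 * w.length * (b : ℝ) ^ d ≤ M * ε ^ 2 := by
    rw [div_lt_iff₀ (by positivity)] at hM2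
    have : (M2 : ℝ) ≤ M := by exact_mod_cast (by omega : M2 ≤ M)
    nlinarith [sq_nonneg ε]
  set a : ℝ := ε * M / 4 with ha
  have ha0 : 0 ≤ a := by positivity
  set G := deviant w M a
  have hG : G.card ≤ b ^ (M - d) := by
    have h1 := card_deviant_mul_sq_le w (show w.length ≤ M by omega) ha0
    have h2 : (G.card : ℝ) * b ^ d ≤ b ^ M := by
      have h3 : (M : ℝ) * ((G.card : ℝ) * (M * ε ^ 2)) ≤
          M * ((32 * w.length) * (b : ℝ) ^ M) := by
        rw [ha] at h1
        nlinarith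
      have h4 := le_of_mul_le_mul_left h3 hMpos
      have h5 : (M * ε ^ 2) * ((G.card : ℝ) * b ^ d) ≤ (M * ε ^ 2) * b ^ M := by
        calc (M * ε ^ 2) * ((G.card : ℝ) * b ^ d) = ((G.card : ℝ) * (M * ε ^ 2)) * b ^ d := by
              ring
          _ ≤ ((32 * w.length) * (b : ℝ) ^ M) * b ^ d := by gcongr
          _ = (32 * w.length * (b : ℝ) ^ d) * b ^ M := by ring
          _ ≤ _ := by gcongr
      exact le_of_mul_le_mul_left h5 (by positivity)
    have h6 : G.card * b ^ d ≤ b ^ (M - d) * b ^ d := by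
      rw [← pow_add, Nat.sub_add_cancel (by omega)]
      exact_mod_cast h2
    exact Nat.le_of_mul_le_mul_right h6 (pow_pos (NeZero.pos b) d)
  obtain ⟨T, hT⟩ := exists_transducer_of_card_le hb (show d ≤ M by omega) G hG
  have hM1R : (1 : ℝ) ≤ M := by exact_mod_cast (by omega : 1 ≤ M)
  have hMinv : (M : ℝ)⁻¹ ≤ 1 := inv_le_one_of_one_le₀ hM1R
  have hMinv0 : 0 < (M : ℝ)⁻¹ := by positivity
  obtain ⟨N1, hN1⟩ := exists_nat_gt (4 / ε)
  have hfreq : ∃ᶠ n : ℕ in atTop, ∃ p, T.output p = prefixWord (seqOf b x) n ∧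
      p.length ≤ (1 - (M : ℝ)⁻¹) * n := by
    refine frequently_atTop.mpr fun n0 => ?_
    obtain ⟨n, hn, hnε⟩ := hdev ((n0 + N1 + 1) * M)
    set N := n / M with hN
    have hNge : n0 + N1 + 1 ≤ N := (Nat.le_div_iff_mul_le (by omega)).mpr hn
    refine ⟨N * M, by nlinarith, ?_⟩
    obtain ⟨p, hp, hpl⟩ := hT (seqOf b x) N
    refine ⟨p, hp, ?_⟩
    have hdl := deviation_le (seqOf b x) w (show w.length ≤ M by omega) (by omega) n ha0
    rw [← hN] at hdl
    set g := {I ∈ range N | block (seqOf b x) M I ∈ deviant w M a}.card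
    have hNM : (N : ℝ) * M ≤ n := by exact_mod_cast Nat.div_mul_le_self n M
    have hNpos : (0 : ℝ) < N := by exact_mod_cast (by omega : 0 < N)
    have hnpos : (0 : ℝ) < n := lt_of_lt_of_le (by positivity) hNM
    have h1 : ε * n ≤ |(occurrences (seqOf b x) w n : ℝ) - n * ((b : ℝ) ^ w.length)⁻¹| := by
      have e : (occurrences (seqOf b x) w n : ℝ) - n * ((b : ℝ) ^ w.length)⁻¹ =
          n * ((occurrences (seqOf b x) w n : ℝ) / n - ((b : ℝ) ^ w.length)⁻¹) := by
        field_simp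
      rw [e, abs_mul, abs_of_pos hnpos, mul_comm]
      gcongr
    have h2 : ε * (N * M) ≤ N * (ε * M / 2) + g * M + M := by
      calc ε * (N * M) ≤ ε * n := by gcongr
        _ ≤ N * (a + w.length) + g * M + M := h1.trans hdl
        _ ≤ _ := by
          gcongr
          rw [ha]; linarith
    have h3 : ε * N / 2 ≤ g + 1 := by
      refine le_of_mul_le_mul_right ?_ hMpos
      linarith
    -- Enough blocks to absorb the 1 that comes from the incomplete last block.
    have h4 : 4 ≤ N * ε := by
      rw [div_lt_iff₀ hε] at hN1
      have : (N1 : ℝ) ≤ N := by exact_mod_cast (by omega : N1 ≤ N)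
      nlinarith
    have h5 : ε * N / 4 ≤ g := by linarith
    have h6 : 2 * (N : ℝ) ≤ d * g := by
      calc 2 * (N : ℝ) = 8 / ε * (ε * N / 4) := by field_simp; norm_num
        _ ≤ d * g := by gcongr
    have h7 : (p.length : ℝ) + d * g = N * (M + 1) := by exact_mod_cast hpl
    have h8 : (1 - (M : ℝ)⁻¹) * ((N * M : ℕ) : ℝ) = N * M - N := by
      push_cast; field_simp
    rw [h8]
    linarith
  have := dimFS_le_of_frequently hb hx T (c := 1 - (M : ℝ)⁻¹) (c' := 1 - (M : ℝ)⁻¹ / 2)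
    (by linarith) (by linarith) hfreq
  refine this.trans_lt ?_
  rw [← ENNReal.ofReal_one]
  exact (ENNReal.ofReal_lt_ofReal_iff one_pos).mpr (by linarith)

end FSDim

theorem mainTheorem2 (b : ℕ) [NeZero b] (hb : 2 ≤ b) (x : ℝ) (hx : x ∈ Set.Ico (0 : ℝ) 1) :
    FSDim.IsNormal b x ↔ FSDim.dimFS b x = 1 := by
  refine ⟨fun h => le_antisymm (FSDim.dimFS_le_one hb hx) (h.one_le_dimFS hb hx), fun h => ?_⟩
  by_contra hn
  exact (FSDim.dimFS_lt_one_of_not_isNormal hb hx hn).ne h
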